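/- Let $(X_{1,j}, X_{2,j})$, $j \ge 1$, be iid random vectors in the plane with square-integrable coordinates; for $i = 1, 2$ let $\mu_i$ and $\sigma_i^2$ be the mean and the variance of $X_{i,1}$, with $\sigma_i > 0$, and let the correlation coefficient $\rho$ of $X_{1,j}$ and $X_{2,j}$ (which does not depend on $j$) be nonzero. For a pair $\alpha = (n_1, n_2)$ of positive integers let $\bar X_{i,n_i} = \frac{1}{n_i}\sum_{j=1}^{n_i} X_{i,j}$, let $e_\alpha = n_1/n_2$, let $H_\alpha$ be the law on $\mathbb{R}^2$ of $$\left(\frac{\sqrt{n_1}\,(\bar X_{1,n_1} - \mu_1)}{\sigma_1},\ \frac{\sqrt{n_2}\,(\bar X_{2,n_2} - \mu_2)}{\sigma_2}\right),$$ and let $\widehat F_\alpha$ be the law on $\mathbb{R}$ of $$\frac{(\bar X_{1,n_1} - \mu_1) - (\bar X_{2,n_2} - \mu_2)}{\sqrt{\sigma_1^2/n_1 + \sigma_2^2/n_2}}.$$ Order the pairs $\alpha$ coordinatewise, let $\mathcal{F}$ be a directed set, and let $\phi$ be an order preserving map from $\mathcal{F}$ to the set of pairs which is cofinal, i.e. for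 every pair $\alpha$ there is $\beta \in \mathcal{F}$ with $\phi(\beta) \ge \alpha$. If $\lim_{\beta \in \mathcal{F}} e_{\phi(\beta)} = 1$, then, in the sense of weak convergence of probability measures, along the net $\beta \in \mathcal{F}$, $H_{\phi(\beta)}$ converges to the bivariate normal distribution with means $0$, variances $1$ and correlation coefficient $\rho$, and $\widehat F_{\phi(\beta)}$ converges to the normal distribution $N(0, 1 - \rho^*)$, where $$\rho^* = \frac{2\sigma_1\sigma_2}{\sigma_1^2 + \sigma_2^2}\,\rho$$ and $N(0,0)$ denotes the point mass at $0$. -/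

import Mathlib

open MeasureTheory ProbabilityTheory Filter Topology

noncomputable section

namespace StdMeans

variable {Ω : Type*} [MeasurableSpace Ω]

/-- Standard deviation of a real random variable. -/
def sd (X : Ω → ℝ) (P : Measure Ω) : ℝ := √(Var[X; P])

/-- Pearson correlation coefficient (`0` by convention if one of the variances vanishes, so a
nonzero correlation forces both standard deviations to be positive). -/
def correlation (X Y : Ω → ℝ) (P : Measure Ω) : ℝ := cov[X, Y; P] / (sd X P * sd Y P)

/-- Mean of the first `n` terms `X 0, …, X (n - 1)` of a sequence of random variables. -/
def sampleMean (X : ℕ → Ω → ℝ) (n : ℕ+) (ω : Ω) : ℝ :=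
  (∑ j ∈ Finset.range n, X j ω) / (n : ℝ)

/-- Standardized sample mean `√n (X̄ₙ - μ) / σ` of an identically distributed sequence,
`μ` and `σ` being the mean and the standard deviation of its common distribution. -/
def stdMean (X : ℕ → Ω → ℝ) (P : Measure Ω) (n : ℕ+) (ω : Ω) : ℝ :=
  √(n : ℝ) * (sampleMean X n ω - P[X 0]) / sd (X 0) P

/-- The random vector in the plane formed by the two standardized sample means, for the pair of
sample sizes `α = (n₁, n₂)`. -/
def stdMeanPair (X₁ X₂ : ℕ → Ω → ℝ) (P : Measure Ω) (α : ℕ+ × ℕ+) (ω : Ω) :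
    EuclideanSpace ℝ (Fin 2) :=
  !₂[stdMean X₁ P α.1 ω, stdMean X₂ P α.2 ω]

/-- The standardized difference of the two sample means, for sample sizes `α = (n₁, n₂)`:
`((X̄₁ - μ₁) - (X̄₂ - μ₂)) / √(σ₁² / n₁ + σ₂² / n₂)`. -/
def stdDiff (X₁ X₂ : ℕ → Ω → ℝ) (P : Measure Ω) (α : ℕ+ × ℕ+) (ω : Ω) : ℝ :=
  ((sampleMean X₁ α.1 ω - P[X₁ 0]) - (sampleMean X₂ α.2 ω - P[X₂ 0])) /
    √(sd (X₁ 0) P ^ 2 / (α.1 : ℝ) + sd (X₂ 0) P ^ 2 / (α.2 : ℝ))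

/-- The ratio `n₁ / n₂` of the sample sizes `α = (n₁, n₂)`. -/
def sizeRatio (α : ℕ+ × ℕ+) : ℝ := (α.1 : ℝ) / (α.2 : ℝ)

/-- `ρ* = 2 σ₁ σ₂ ρ / (σ₁² + σ₂²)`. -/
def rhoStar (σ₁ σ₂ ρ : ℝ) : ℝ := 2 * σ₁ * σ₂ / (σ₁ ^ 2 + σ₂ ^ 2) * ρ

/-- Bivariate normal distribution with means `0`, variances `1` and correlation `ρ`
(meaningful for `ρ ∈ [-1, 1]`, when the covariance matrix is positive semidefinite). -/
abbrev bivariateNormal (ρ : ℝ) : Measure (EuclideanSpace ℝ (Fin 2)) :=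
  multivariateGaussian 0 !![1, ρ; ρ, 1]

/-- Normal distribution on the line with mean `0` and variance `θ ≥ 0`;
the point mass at `0` for `θ = 0`. -/
abbrev centeredNormal (θ : ℝ) : Measure ℝ := gaussianReal 0 θ.toNNReal

end StdMeans

end

namespace StdMeans

variable {Ω : Type*} [MeasurableSpace Ω] {P : Measure Ω} [IsProbabilityMeasure P]

/-! For equal sample sizes the first claim is the planar central limit theorem, which characteristic
functions reduce to the one on the line (`tendstoInDistribution_stdMeanPair_diag`). Standardized
means of one sequence at sizes n and m have covariance √(min/max), so their L² distance vanishes as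
n/m → 1 (`variance_stdMean_sub`). Replacing the second size by the first is therefore harmless, by
Slutsky. The standardized difference is a linear form in the pair whose coefficients depend only on
n₁/n₂ (`stdDiff_eq`), so Slutsky applies again. All limits are taken along the filter `balanced`;
the net enters only at the end, since it tends to `balanced`. -/

lemma stdMean_eq (X : ℕ → Ω → ℝ) (P : Measure Ω) (n : ℕ+) (ω : Ω) :
    stdMean X P n ω =
      (√(n : ℝ))⁻¹ * (∑ j ∈ Finset.range n, X j ω - n * P[X 0]) / sd (X 0) P := by
  have hn : (0 : ℝ) < n := by exact_mod_cast n.pos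
  have hs : √(n : ℝ) ≠ 0 := (Real.sqrt_pos.2 hn).ne'
  have h2 : √(n : ℝ) ^ 2 = n := Real.sq_sqrt hn.le
  rw [stdMean, sampleMean]
  congr 1
  field_simp
  rw [h2]

lemma stdMean_eq_sum (X : ℕ → Ω → ℝ) (P : Measure Ω) (n : ℕ+) :
    stdMean X P n = fun ω =>
      ((√(n : ℝ))⁻¹ / sd (X 0) P) * (∑ j ∈ Finset.range n, X j ω)
        - ((√(n : ℝ))⁻¹ / sd (X 0) P) * (n * P[X 0]) := by
  funext ω
  rw [stdMean_eq]
  ring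

lemma memLp_stdMean {X : ℕ → Ω → ℝ} (hX : ∀ j, MemLp (X j) 2 P) (n : ℕ+) :
    MemLp (stdMean X P n) 2 P := by
  rw [stdMean_eq_sum]
  exact ((memLp_finsetSum _ fun j _ => hX j).const_mul _).sub (memLp_const _)

lemma integral_stdMean {X : ℕ → Ω → ℝ} (hX : ∀ j, MemLp (X j) 2 P)
    (hident : ∀ j, IdentDistrib (X j) (X 0) P P) (n : ℕ+) : P[stdMean X P n] = 0 := by
  have hi : ∀ j, Integrable (X j) P := fun j => (hX j).integrable (by norm_num)
  rw [stdMean_eq_sum, integral_sub ((integrable_finsetSum _ fun j _ => hi j).const_mul _)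
    (integrable_const _), integral_const_mul, integral_finsetSum _ fun j _ => hi j]
  simp [fun j => (hident j).integral_eq]

lemma covariance_sum_range {X : ℕ → Ω → ℝ} (hX : ∀ j, MemLp (X j) 2 P)
    (hident : ∀ j, IdentDistrib (X j) (X 0) P P) (hindep : iIndepFun X P) {n m : ℕ}
    (h : n ≤ m) :
    cov[fun ω => ∑ j ∈ Finset.range n, X j ω, fun ω => ∑ j ∈ Finset.range m, X j ω; P] =
      n * Var[X 0; P] := by
  rw [covariance_fun_sum_fun_sum' (fun j _ => hX j) (fun j _ => hX j)]
  have : ∀ i ∈ Finset.range n, ∑ j ∈ Finset.range m, cov[X i, X j; P] = Var[X 0; P] := by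
    intro i hi
    rw [Finset.sum_eq_single i]
    · rw [covariance_self (hX i).aestronglyMeasurable.aemeasurable, (hident i).variance_eq]
    · intro j _ hj
      exact (hindep.indepFun hj.symm).covariance_eq_zero (hX i) (hX j)
    · intro hi'
      simp only [Finset.mem_range] at hi hi'
      omega
  simp [Finset.sum_congr rfl this]

/-- Only the n shared terms correlate, giving n / (√n √m). -/
lemma covariance_stdMean {X : ℕ → Ω → ℝ} (hX : ∀ j, MemLp (X j) 2 P)
    (hident : ∀ j, IdentDistrib (X j) (X 0) P P) (hindep : iIndepFun X P)
    (hσ : 0 < sd (X 0) P) {n m : ℕ+} (h : n ≤ m) :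
    cov[stdMean X P n, stdMean X P m; P] = √((n : ℝ) / m) := by
  have hn : (0 : ℝ) < n := by exact_mod_cast n.pos
  have hm : (0 : ℝ) < m := by exact_mod_cast m.pos
  have hi : ∀ (c : ℝ) (n : ℕ), Integrable (fun ω => c * ∑ j ∈ Finset.range n, X j ω) P :=
    fun c n => (integrable_finsetSum _ fun j _ => (hX j).integrable (by norm_num)).const_mul _
  rw [stdMean_eq_sum, stdMean_eq_sum, covariance_sub_const_left (hi _ _),
    covariance_sub_const_right (hi _ _), covariance_const_mul_left, covariance_const_mul_right,
    covariance_sum_range hX hident hindep (by exact_mod_cast h)]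
  have hv : Var[X 0; P] = sd (X 0) P ^ 2 := (Real.sq_sqrt (variance_nonneg _ _)).symm
  have h2 : √(n : ℝ) ^ 2 = n := Real.sq_sqrt hn.le
  have hs : √(n : ℝ) ≠ 0 := (Real.sqrt_pos.2 hn).ne'
  have hs' : √(m : ℝ) ≠ 0 := (Real.sqrt_pos.2 hm).ne'
  rw [hv, Real.sqrt_div hn.le]
  field_simp
  rw [h2]

/-- Both variances are 1. The `min` selects the ratio at most 1, so the formula covers either order
of the sizes. -/
lemma variance_stdMean_sub {X : ℕ → Ω → ℝ} (hX : ∀ j, MemLp (X j) 2 P)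
    (hident : ∀ j, IdentDistrib (X j) (X 0) P P) (hindep : iIndepFun X P)
    (hσ : 0 < sd (X 0) P) (n m : ℕ+) :
    Var[stdMean X P n - stdMean X P m; P] = 2 - 2 * min √((n : ℝ) / m) √((m : ℝ) / n) := by
  have hself : ∀ k : ℕ+, Var[stdMean X P k; P] = 1 := by
    intro k
    have hk : (k : ℝ) ≠ 0 := by exact_mod_cast k.ne_zero
    rw [← covariance_self (memLp_stdMean hX k).aestronglyMeasurable.aemeasurable,
      covariance_stdMean hX hident hindep hσ le_rfl, div_self hk, Real.sqrt_one]
  have hle : ∀ {k l : ℕ+}, k ≤ l → √((k : ℝ) / l) ≤ √((l : ℝ) / k) := by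
    intro k l hkl
    have hk : (0 : ℝ) < k := by exact_mod_cast k.pos
    have hl : (0 : ℝ) < l := by exact_mod_cast l.pos
    have hkl' : (k : ℝ) ≤ l := by exact_mod_cast hkl
    exact Real.sqrt_le_sqrt (((div_le_one hl).2 hkl').trans ((one_le_div hk).2 hkl'))
  rw [variance_sub (memLp_stdMean hX n) (memLp_stdMean hX m), hself, hself]
  rcases le_total n m with h | h
  · rw [covariance_stdMean hX hident hindep hσ h, min_eq_left (hle h)]
    ring
  · rw [covariance_comm, covariance_stdMean hX hident hindep hσ h, min_eq_right (hle h)]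
    ring

/-! ### Balanced sample sizes -/

/-- Sample sizes tending to infinity with ratio tending to `1`. -/
noncomputable def balanced : Filter (ℕ+ × ℕ+) := atTop ⊓ comap sizeRatio (𝓝 1)

/-- Needed for the Slutsky-type arguments; `atTop` on a general directed set need not have this
property. -/
instance : balanced.IsCountablyGenerated := by
  unfold balanced
  infer_instance

lemma tendsto_sizeRatio_balanced : Tendsto sizeRatio balanced (𝓝 1) :=
  tendsto_comap.mono_left inf_le_right

lemma tendsto_fst_balanced : Tendsto Prod.fst balanced atTop := by
  refine Tendsto.mono_left ?_ inf_le_left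
  rw [← prod_atTop_atTop_eq]
  exact tendsto_fst

lemma tendstoInMeasure_stdMean_sub {X : ℕ → Ω → ℝ} (hX : ∀ j, MemLp (X j) 2 P)
    (hident : ∀ j, IdentDistrib (X j) (X 0) P P) (hindep : iIndepFun X P)
    (hσ : 0 < sd (X 0) P) :
    TendstoInMeasure P (fun α : ℕ+ × ℕ+ => stdMean X P α.2 - stdMean X P α.1) balanced 0 := by
  have hr := tendsto_sizeRatio_balanced
  have hlim : Tendsto (fun α : ℕ+ × ℕ+ => Var[stdMean X P α.2 - stdMean X P α.1; P])
      balanced (𝓝 0) := by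
    have h1 : Tendsto (fun α => √(sizeRatio α)) balanced (𝓝 1) := by
      simpa using hr.sqrt
    have h2 : Tendsto (fun α => √((sizeRatio α)⁻¹)) balanced (𝓝 1) := by
      simpa using (hr.inv₀ one_ne_zero).sqrt
    have h3 := ((h2.min h1).const_mul 2).const_sub 2
    simp only [min_self, mul_one, sub_self] at h3
    refine h3.congr fun α => ?_
    rw [variance_stdMean_sub hX hident hindep hσ]
    simp [sizeRatio]
  rw [tendstoInMeasure_iff_measureReal_norm]
  intro ε hε
  have hbound : Tendsto (fun α : ℕ+ × ℕ+ =>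
      Var[stdMean X P α.2 - stdMean X P α.1; P] / ε ^ 2) balanced (𝓝 0) := by
    simpa using hlim.div_const (ε ^ 2)
  refine squeeze_zero (fun _ => measureReal_nonneg) (fun α => ?_) hbound
  have hL := (memLp_stdMean hX α.2).sub (memLp_stdMean hX α.1)
  have h0 : P[stdMean X P α.2 - stdMean X P α.1] = 0 := by
    simp only [Pi.sub_apply]
    rw [integral_sub ((memLp_stdMean hX α.2).integrable (by norm_num))
      ((memLp_stdMean hX α.1).integrable (by norm_num)), integral_stdMean hX hident,
      integral_stdMean hX hident, sub_zero]
  -- Chebyshev's inequality, the difference being centered.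
  have h := meas_ge_le_variance_div_sq hL hε
  rw [h0] at h
  simp only [sub_zero, Pi.zero_apply, Real.norm_eq_abs] at h ⊢
  exact ENNReal.toReal_le_of_le_ofReal (div_nonneg (variance_nonneg _ _) (sq_nonneg _)) h

/-! ### Linear forms and the bivariate normal law -/

/-- The quadratic form of the correlation matrix is a variance. -/
lemma variance_linear_combination {X Y : Ω → ℝ} (hX : MemLp X 2 P) (hY : MemLp Y 2 P)
    (hσX : 0 < sd X P) (hσY : 0 < sd Y P) (a b : ℝ) :
    Var[fun ω => a / sd X P * X ω + b / sd Y P * Y ω; P] =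
      a ^ 2 + 2 * correlation X Y P * a * b + b ^ 2 := by
  have hvX : Var[X; P] = sd X P ^ 2 := (Real.sq_sqrt (variance_nonneg _ _)).symm
  have hvY : Var[Y; P] = sd Y P ^ 2 := (Real.sq_sqrt (variance_nonneg _ _)).symm
  rw [variance_fun_add (hX.const_mul _) (hY.const_mul _), variance_const_mul, variance_const_mul,
    covariance_const_mul_left, covariance_const_mul_right, hvX, hvY, correlation]
  field_simp

lemma dotProduct_correlation_mulVec (ρ : ℝ) (t : Fin 2 → ℝ) :
    t ⬝ᵥ (!![1, ρ; ρ, 1] : Matrix (Fin 2) (Fin 2) ℝ).mulVec t =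
      t 0 ^ 2 + 2 * ρ * t 0 * t 1 + t 1 ^ 2 := by
  simp [dotProduct, Matrix.mulVec, Fin.sum_univ_two]
  ring

lemma posSemidef_correlation {X Y : Ω → ℝ} (hX : MemLp X 2 P) (hY : MemLp Y 2 P)
    (hσX : 0 < sd X P) (hσY : 0 < sd Y P) :
    (!![1, correlation X Y P; correlation X Y P, 1] : Matrix (Fin 2) (Fin 2) ℝ).PosSemidef := by
  refine Matrix.PosSemidef.of_dotProduct_mulVec_nonneg ?_ fun t => ?_
  · ext i j
    fin_cases i <;> fin_cases j <;> simp
  · rw [star_trivial, dotProduct_correlation_mulVec,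
      ← variance_linear_combination hX hY hσX hσY]
    exact variance_nonneg _ _

lemma inner_euclidean_two (x t : EuclideanSpace ℝ (Fin 2)) :
    inner ℝ x t = t 0 * x 0 + t 1 * x 1 := by
  simp [PiLp.inner_apply, Fin.sum_univ_two]

-- The Cramér–Wold device: laws of linear forms determine the characteristic function of the vector.
omit [IsProbabilityMeasure P] in
lemma charFun_map_eq_charFun_map_linear {Y : Ω → EuclideanSpace ℝ (Fin 2)}
    (hY : AEMeasurable Y P) (t : EuclideanSpace ℝ (Fin 2)) (s : ℝ) :
    charFun (P.map fun ω => t 0 * Y ω 0 + t 1 * Y ω 1) s = charFun (P.map Y) (s • t) := by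
  rw [charFun_apply, charFun_apply, integral_map (by fun_prop) (by fun_prop),
    integral_map hY (by fun_prop)]
  refine integral_congr_ae (ae_of_all _ fun ω => ?_)
  simp only [inner_smul_right, inner_euclidean_two]
  simp

lemma charFun_bivariateNormal {ρ : ℝ}
    (hS : (!![1, ρ; ρ, 1] : Matrix (Fin 2) (Fin 2) ℝ).PosSemidef)
    (t : EuclideanSpace ℝ (Fin 2)) :
    charFun (bivariateNormal ρ) t =
      Complex.exp (-((t 0 ^ 2 + 2 * ρ * t 0 * t 1 + t 1 ^ 2 : ℝ) : ℂ) / 2) := by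
  rw [bivariateNormal, charFun_multivariateGaussian hS, dotProduct_correlation_mulVec]
  congr 1
  push_cast
  simp
  ring

lemma map_bivariateNormal_linear {X Y : Ω → ℝ} (hX : MemLp X 2 P) (hY : MemLp Y 2 P)
    (hσX : 0 < sd X P) (hσY : 0 < sd Y P) (t : EuclideanSpace ℝ (Fin 2)) :
    (bivariateNormal (correlation X Y P)).map (fun x => t 0 * x 0 + t 1 * x 1) =
      centeredNormal (t 0 ^ 2 + 2 * correlation X Y P * t 0 * t 1 + t 1 ^ 2) := by
  have hS := posSemidef_correlation hX hY hσX hσY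
  refine Measure.ext_of_charFun (funext fun s => ?_)
  have h := charFun_map_eq_charFun_map_linear
    (P := bivariateNormal (correlation X Y P)) aemeasurable_id t s
  simp only [id_eq, Measure.map_id] at h
  rw [h, charFun_bivariateNormal hS, charFun_gaussianReal, Real.coe_toNNReal]
  · simp
    ring_nf
  · rw [← variance_linear_combination hX hY hσX hσY]
    exact variance_nonneg _ _

lemma aemeasurable_stdMeanPair {X₁ X₂ : ℕ → Ω → ℝ} (hL1 : ∀ j, MemLp (X₁ j) 2 P)
    (hL2 : ∀ j, MemLp (X₂ j) 2 P) (α : ℕ+ × ℕ+) : AEMeasurable (stdMeanPair X₁ X₂ P α) P := by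
  have h1 := (memLp_stdMean hL1 α.1).aestronglyMeasurable.aemeasurable
  have h2 := (memLp_stdMean hL2 α.2).aestronglyMeasurable.aemeasurable
  refine (WithLp.measurable_toLp 2 _).comp_aemeasurable (aemeasurable_pi_lambda _ fun i => ?_)
  fin_cases i
  · exact h1
  · exact h2

-- With equal sizes, a linear form in the pair is the normalized sum of a single iid sequence, as
-- the central limit theorem on the line requires.
omit [IsProbabilityMeasure P] in
lemma linear_stdMeanPair (X₁ X₂ : ℕ → Ω → ℝ) (hL1 : Integrable (X₁ 0) P)
    (hL2 : Integrable (X₂ 0) P) (n : ℕ+) (a b : ℝ) (ω : Ω) :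
    a * stdMeanPair X₁ X₂ P (n, n) ω 0 + b * stdMeanPair X₁ X₂ P (n, n) ω 1 =
      (√((n : ℕ) : ℝ))⁻¹ * (∑ j ∈ Finset.range n,
          (a / sd (X₁ 0) P * X₁ j ω + b / sd (X₂ 0) P * X₂ j ω)
        - (n : ℕ) * P[fun ω => a / sd (X₁ 0) P * X₁ 0 ω + b / sd (X₂ 0) P * X₂ 0 ω]) := by
  rw [integral_add (hL1.const_mul _) (hL2.const_mul _), integral_const_mul, integral_const_mul,
    Finset.sum_add_distrib, ← Finset.mul_sum, ← Finset.mul_sum]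
  simp only [stdMeanPair, stdMean_eq]
  simp
  ring

/-! ### Limit of the pair of standardized means -/

section Limit

variable {X₁ X₂ : ℕ → Ω → ℝ}
  (hindep : iIndepFun (fun (j : ℕ) (ω : Ω) => (X₁ j ω, X₂ j ω)) P)
  (hident : ∀ j : ℕ,
    IdentDistrib (fun ω => (X₁ j ω, X₂ j ω)) (fun ω => (X₁ 0 ω, X₂ 0 ω)) P P)
  (hL1 : ∀ j : ℕ, MemLp (X₁ j) 2 P) (hL2 : ∀ j : ℕ, MemLp (X₂ j) 2 P)
  (hσ₁ : 0 < sd (X₁ 0) P) (hσ₂ : 0 < sd (X₂ 0) P)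

include hindep hident hL1 hL2 hσ₁ hσ₂

/-- Bivariate central limit theorem for equal sample sizes. -/
lemma tendstoInDistribution_stdMeanPair_diag :
    TendstoInDistribution (fun n : ℕ => stdMeanPair X₁ X₂ P (n.succPNat, n.succPNat)) atTop id
      (fun _ => P) (bivariateNormal (correlation (X₁ 0) (X₂ 0) P)) where
  forall_aemeasurable n := aemeasurable_stdMeanPair hL1 hL2 _
  tendsto := by
    have hS := posSemidef_correlation (hL1 0) (hL2 0) hσ₁ hσ₂
    refine ProbabilityMeasure.tendsto_iff_tendsto_charFun.2 fun t => ?_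
    let Y : ℕ → Ω → ℝ := fun j ω => t 0 / sd (X₁ 0) P * X₁ j ω + t 1 / sd (X₂ 0) P * X₂ j ω
    let g : ℝ × ℝ → ℝ := fun p => t 0 / sd (X₁ 0) P * p.1 + t 1 / sd (X₂ 0) P * p.2
    have hg : Measurable g := by fun_prop
    have hclt := tendstoInDistribution_inv_sqrt_mul_sum_sub (X := Y) (P := P) (Y := id)
      (P' := gaussianReal 0 Var[Y 0; P].toNNReal) HasLaw.id
      (((hL1 0).const_mul _).add ((hL2 0).const_mul _))
      (hindep.comp (fun _ => g) fun _ => hg) (fun j => (hident j).comp hg)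
    -- Evaluation at 1 suffices since `t` is arbitrary; the shift by one matches `succPNat`.
    have hlim := (ProbabilityMeasure.tendsto_iff_tendsto_charFun.1 hclt.tendsto 1).comp
      (tendsto_add_atTop_nat 1)
    have hv : Var[Y 0; P] = _ := variance_linear_combination (hL1 0) (hL2 0) hσ₁ hσ₂ (t 0) (t 1)
    simp only [ProbabilityMeasure.coe_mk, Measure.map_id] at hlim ⊢
    rw [charFun_bivariateNormal hS]
    rw [charFun_gaussianReal, Real.coe_toNNReal _ (variance_nonneg _ _), hv] at hlim
    convert! hlim using 2 with n
    · have h := charFun_map_eq_charFun_map_linear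
        (aemeasurable_stdMeanPair (P := P) hL1 hL2 (n.succPNat, n.succPNat)) t 1
      rw [one_smul] at h
      rw [← h]
      simp only [Function.comp]
      congr 2
      funext ω
      exact linear_stdMeanPair X₁ X₂ ((hL1 0).integrable (by norm_num))
        ((hL2 0).integrable (by norm_num)) _ _ _ ω
    · congr 1
      push_cast
      ring

lemma tendstoInDistribution_stdMeanPair_balanced :
    TendstoInDistribution (stdMeanPair X₁ X₂ P) balanced id
      (fun _ => P) (bivariateNormal (correlation (X₁ 0) (X₂ 0) P)) := by
  have hdiag := tendstoInDistribution_stdMeanPair_diag hindep hident hL1 hL2 hσ₁ hσ₂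
  have hpred : Tendsto (fun α : ℕ+ × ℕ+ => α.1.natPred) balanced atTop := by
    refine Tendsto.comp (g := PNat.natPred) ?_ tendsto_fst_balanced
    refine tendsto_atTop.2 fun k => ?_
    filter_upwards [eventually_ge_atTop k.succPNat] with n hn
    have h : k + 1 ≤ (n : ℕ) := by exact_mod_cast hn
    simp only [PNat.natPred]
    omega
  have hfst : TendstoInDistribution (fun α : ℕ+ × ℕ+ => stdMeanPair X₁ X₂ P (α.1, α.1)) balanced id
      (fun _ => P) (bivariateNormal (correlation (X₁ 0) (X₂ 0) P)) :=
    { forall_aemeasurable := fun α => aemeasurable_stdMeanPair hL1 hL2 _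
      tendsto := by
        refine (hdiag.tendsto.comp hpred).congr fun α => ?_
        apply Subtype.ext
        simp only [Function.comp, PNat.succPNat_natPred] }
  refine tendstoInDistribution_of_tendstoInMeasure_sub _ _ hfst ?_
    (aemeasurable_stdMeanPair hL1 hL2)
  -- The two pairs share their first coordinate, so their distance is that of the second
  -- coordinates.
  have h2 := tendstoInMeasure_stdMean_sub hL2 (fun j => (hident j).comp measurable_snd)
    (hindep.comp (fun _ => Prod.snd) fun _ => measurable_snd) hσ₂
  rw [tendstoInMeasure_iff_norm] at h2 ⊢
  intro ε hε
  refine (h2 ε hε).congr fun α => ?_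
  congr 2
  funext ω
  simp [stdMeanPair, EuclideanSpace.norm_eq, Fin.sum_univ_two, Real.sqrt_sq_eq_abs]

end Limit

/-! ### Limit of the standardized difference -/

omit [IsProbabilityMeasure P] in
/-- Coefficients of the standardized difference in terms of the standardized means. -/
lemma stdDiff_eq (X₁ X₂ : ℕ → Ω → ℝ) (hσ₁ : 0 < sd (X₁ 0) P) (hσ₂ : 0 < sd (X₂ 0) P)
    (α : ℕ+ × ℕ+) (ω : Ω) :
    stdDiff X₁ X₂ P α ω =
      sd (X₁ 0) P / √(sd (X₁ 0) P ^ 2 + sd (X₂ 0) P ^ 2 * sizeRatio α)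
          * stdMeanPair X₁ X₂ P α ω 0 +
        -(sd (X₂ 0) P * √(sizeRatio α)) / √(sd (X₁ 0) P ^ 2 + sd (X₂ 0) P ^ 2 * sizeRatio α)
          * stdMeanPair X₁ X₂ P α ω 1 := by
  obtain ⟨n, m⟩ := α
  have hn : (0 : ℝ) < n := by exact_mod_cast n.pos
  have hm : (0 : ℝ) < m := by exact_mod_cast m.pos
  have hn' := Real.sqrt_pos.2 hn
  have hm' := Real.sqrt_pos.2 hm
  -- Factoring out 1/√n₁ leaves a function of the ratio alone.
  have hD : √(sd (X₁ 0) P ^ 2 / (n : ℝ) + sd (X₂ 0) P ^ 2 / (m : ℝ)) =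
      √(sd (X₁ 0) P ^ 2 + sd (X₂ 0) P ^ 2 * (n / m)) / √n := by
    rw [← Real.sqrt_div (by positivity)]
    congr 1
    field_simp
  have hpos : 0 < √(sd (X₁ 0) P ^ 2 + sd (X₂ 0) P ^ 2 * ((n : ℝ) / m)) :=
    Real.sqrt_pos.2 (by positivity)
  simp only [stdDiff, stdMeanPair, stdMean, sizeRatio, hD, Real.sqrt_div hn.le]
  simp
  field_simp
  ring

/-- The standardized difference is asymptotically normal for balanced sample sizes. -/
lemma tendstoInDistribution_stdDiff_balanced {X₁ X₂ : ℕ → Ω → ℝ}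
    (hindep : iIndepFun (fun (j : ℕ) (ω : Ω) => (X₁ j ω, X₂ j ω)) P)
    (hident : ∀ j : ℕ,
      IdentDistrib (fun ω => (X₁ j ω, X₂ j ω)) (fun ω => (X₁ 0 ω, X₂ 0 ω)) P P)
    (hL1 : ∀ j : ℕ, MemLp (X₁ j) 2 P) (hL2 : ∀ j : ℕ, MemLp (X₂ j) 2 P)
    (hσ₁ : 0 < sd (X₁ 0) P) (hσ₂ : 0 < sd (X₂ 0) P) :
    TendstoInDistribution (stdDiff X₁ X₂ P) balanced id (fun _ => P)
      (centeredNormal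
        (1 - rhoStar (sd (X₁ 0) P) (sd (X₂ 0) P) (correlation (X₁ 0) (X₂ 0) P))) := by
  set s₁ := sd (X₁ 0) P with hs₁
  set s₂ := sd (X₂ 0) P with hs₂
  have hpos : 0 < s₁ ^ 2 + s₂ ^ 2 := by positivity
  set D := √(s₁ ^ 2 + s₂ ^ 2) with hD
  have hD0 : 0 < D := Real.sqrt_pos.2 hpos
  have hDsq : D ^ 2 = s₁ ^ 2 + s₂ ^ 2 := Real.sq_sqrt hpos.le
  let c : ℝ → ℝ × ℝ := fun r =>
    (s₁ / √(s₁ ^ 2 + s₂ ^ 2 * r), -(s₂ * √r) / √(s₁ ^ 2 + s₂ ^ 2 * r))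
  have hc : Tendsto (fun α => c (sizeRatio α)) balanced (𝓝 (s₁ / D, -s₂ / D)) := by
    have hcont : ContinuousAt c 1 := by
      have h : √(s₁ ^ 2 + s₂ ^ 2 * 1) ≠ 0 := by
        rw [mul_one]
        exact hD0.ne'
      refine ContinuousAt.prodMk ?_ ?_
      · exact ContinuousAt.div (by fun_prop) (by fun_prop) h
      · exact ContinuousAt.div (by fun_prop) (by fun_prop) h
    have h := hcont.tendsto.comp tendsto_sizeRatio_balanced
    simpa [c, ← hD, Function.comp_def] using h
  have hcm : TendstoInMeasure P (fun α (_ : Ω) => c (sizeRatio α)) balanced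
      (fun _ => (s₁ / D, -s₂ / D)) := by
    rw [tendstoInMeasure_iff_norm]
    intro ε hε
    refine tendsto_const_nhds.congr' ?_
    -- The coefficients are deterministic, so the exceptional event is eventually empty.
    filter_upwards [Metric.tendsto_nhds.1 hc ε hε] with α hα
    rw [dist_eq_norm] at hα
    simp [not_le.2 hα]
  have hpair := tendstoInDistribution_stdMeanPair_balanced hindep hident hL1 hL2 hσ₁ hσ₂
  have h := hpair.continuous_comp_prodMk_of_tendstoInMeasure_const
    (g := fun p : EuclideanSpace ℝ (Fin 2) × (ℝ × ℝ) => p.2.1 * p.1 0 + p.2.2 * p.1 1)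
    (by fun_prop) hcm fun _ => aemeasurable_const
  have hfun : stdDiff X₁ X₂ P = fun α ω => (c (sizeRatio α)).1 * stdMeanPair X₁ X₂ P α ω 0 +
      (c (sizeRatio α)).2 * stdMeanPair X₁ X₂ P α ω 1 := by
    funext α ω
    exact stdDiff_eq X₁ X₂ hσ₁ hσ₂ α ω
  have hlaw := map_bivariateNormal_linear (hL1 0) (hL2 0) hσ₁ hσ₂ !₂[s₁ / D, -s₂ / D]
  have hvar : (s₁ / D) ^ 2 + 2 * correlation (X₁ 0) (X₂ 0) P * (s₁ / D) * (-s₂ / D)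
      + (-s₂ / D) ^ 2 = 1 - rhoStar s₁ s₂ (correlation (X₁ 0) (X₂ 0) P) := by
    rw [rhoStar, ← hDsq]
    field_simp
    rw [hDsq]
    ring
  simp only [Matrix.cons_val_zero, Matrix.cons_val_one] at hlaw
  rw [hvar] at hlaw
  rw [hfun]
  exact
    { forall_aemeasurable := h.forall_aemeasurable
      tendsto := by
        convert! h.tendsto using 2
        refine congrArg 𝓝 (Subtype.ext ?_)
        simp only [Measure.map_id, id_eq]
        exact hlaw.symm }

omit [IsProbabilityMeasure P] in
lemma sd_pos_of_correlation_ne_zero {X Y : Ω → ℝ} (h : correlation X Y P ≠ 0) :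
    0 < sd X P ∧ 0 < sd Y P := by
  refine ⟨(Real.sqrt_nonneg _).lt_of_ne' fun h0 => h ?_,
    (Real.sqrt_nonneg _).lt_of_ne' fun h0 => h ?_⟩ <;>
  · change sd _ P = 0 at h0
    simp [correlation, h0]

lemma _root_.MeasureTheory.TendstoInDistribution.comp_tendsto {ι κ E Ω' : Type*}
    [TopologicalSpace E] [MeasurableSpace E] [OpensMeasurableSpace E] [MeasurableSpace Ω']
    {Q : Measure Ω'} [IsProbabilityMeasure Q] {X : ι → Ω → E} {Z : Ω' → E} {l : Filter ι}
    (h : TendstoInDistribution X l Z (fun _ => P) Q) {φ : κ → ι} {l' : Filter κ}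
    (hφ : Tendsto φ l' l) :
    TendstoInDistribution (fun k => X (φ k)) l' Z (fun _ => P) Q where
  forall_aemeasurable k := h.forall_aemeasurable (φ k)
  aemeasurable_limit := h.aemeasurable_limit
  tendsto := h.tendsto.comp hφ

end StdMeans

theorem proposition1
    {Ω : Type*} [MeasurableSpace Ω] (P : Measure Ω) [IsProbabilityMeasure P]
    (X₁ X₂ : ℕ → Ω → ℝ)
    (hindep : iIndepFun (fun (j : ℕ) (ω : Ω) => (X₁ j ω, X₂ j ω)) P)
    (hident : ∀ j : ℕ,
      IdentDistrib (fun ω => (X₁ j ω, X₂ j ω)) (fun ω => (X₁ 0 ω, X₂ 0 ω)) P P)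
    (hL1 : ∀ j : ℕ, MemLp (X₁ j) 2 P) (hL2 : ∀ j : ℕ, MemLp (X₂ j) 2 P)
    (ρ : ℝ) (hρ0 : ρ ≠ 0) (hρ : ∀ j : ℕ, StdMeans.correlation (X₁ j) (X₂ j) P = ρ)
    {F : Type*} [Preorder F] [IsDirectedOrder F]
    (φ : F → ℕ+ × ℕ+) (hmono : Monotone φ) (hcofinal : ∀ α : ℕ+ × ℕ+, ∃ β : F, α ≤ φ β)
    (hratio : Tendsto (fun β => StdMeans.sizeRatio (φ β)) atTop (𝓝 1)) :
    TendstoInDistribution (fun β => StdMeans.stdMeanPair X₁ X₂ P (φ β)) atTop id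
        (fun _ => P) (StdMeans.bivariateNormal ρ) ∧
      TendstoInDistribution (fun β => StdMeans.stdDiff X₁ X₂ P (φ β)) atTop id
        (fun _ => P)
        (StdMeans.centeredNormal
          (1 - StdMeans.rhoStar (StdMeans.sd (X₁ 0) P) (StdMeans.sd (X₂ 0) P) ρ)) := by
  have hr : StdMeans.correlation (X₁ 0) (X₂ 0) P = ρ := hρ 0
  subst hr
  obtain ⟨hσ₁, hσ₂⟩ := StdMeans.sd_pos_of_correlation_ne_zero hρ0
  -- Monotonicity and cofinality send both sizes to infinity; `hratio` supplies the other half of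
  -- `balanced`.
  have hφ : Tendsto φ atTop StdMeans.balanced := tendsto_inf.2
    ⟨tendsto_atTop_atTop_of_monotone hmono hcofinal, tendsto_comap_iff.2 hratio⟩
  exact ⟨(StdMeans.tendstoInDistribution_stdMeanPair_balanced hindep hident hL1 hL2
      hσ₁ hσ₂).comp_tendsto hφ,
    (StdMeans.tendstoInDistribution_stdDiff_balanced hindep hident hL1 hL2
      hσ₁ hσ₂).comp_tendsto hφ⟩
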